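/- **Proposition (supersymmetry relation, order 7).** Let $q$ be a complex number with $0<|q|<1$, and let $q^{1/2}$ be either of its two square roots; for integers $k$ write $q^{k/2}=(q^{1/2})^k$. Then the infinite products below converge and $$\frac{1}{2q^{1/2}}\left\{\prod_{n\ge 1}\bigl(1+q^{7n-7/2}\bigr)\bigl(1+q^{n-1/2}\bigr)-\prod_{n\ge 1}\bigl(1-q^{7n-7/2}\bigr)\bigl(1-q^{n-1/2}\bigr)\right\}=\prod_{n\ge 1}\bigl(1+q^{7n}\bigr)\bigl(1+q^{n}\bigr).$$ -/

import Mathlib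

open Filter Topology

/-! Write E(x) = ∏(1 - x^n) and F(x) = E(x)E(x^7). Splitting E into odd and even exponents and
cancelling E(q)E(q^7) reduces the claim to F(s) - F(-s) = -2s F(s^4). By the pentagonal number
theorem, 4z^8 F(z^24) is the theta series of a² + 7b² weighted by χ₁₂(a)χ₁₂(b). The exponents are 8
mod 24, and the odd part of F collects those divisible by 16, that is a ≡ ±3b mod 8. Putting a = 3b
+ 8d turns a² + 7b² into 16(b² + 3bd + 4d²). Terms with d even cancel under b ↦ -b - 3d; those with
d odd give back, up to sign, half of the same theta series at z^4, since 4(b² + 3bd + 4d²) = (2b +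
3d)² + 7d². -/

/-! ### Convergence and the pentagonal number theorem -/

theorem summable_norm_pow_of_injective {ι : Type*} {x : ℂ} (hx : ‖x‖ < 1) {f : ι → ℕ}
    (hf : Function.Injective f) : Summable fun i => ‖x ^ f i‖ := by
  simpa [Function.comp_def] using
    (summable_geometric_of_lt_one (norm_nonneg x) hx).comp_injective hf

theorem multipliable_one_sub_pow {x : ℂ} (hx : ‖x‖ < 1) {f : ℕ → ℕ}
    (hf : Function.Injective f) : Multipliable fun n => 1 - x ^ f n := by
  simpa [sub_eq_add_neg] using multipliable_one_add_of_summable (f := fun n => -x ^ f n)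
    (by simpa using summable_norm_pow_of_injective hx hf)

theorem multipliable_one_add_pow {x : ℂ} (hx : ‖x‖ < 1) {f : ℕ → ℕ}
    (hf : Function.Injective f) : Multipliable fun n => 1 + x ^ f n :=
  multipliable_one_add_of_summable (summable_norm_pow_of_injective hx hf)

theorem norm_prod_range_one_sub_pow_le {x : ℂ} (hx : ‖x‖ < 1) (k n : ℕ) :
    ‖∏ i ∈ Finset.range n, (1 - x ^ (k + i + 1))‖ ≤ Real.exp (1 - ‖x‖)⁻¹ := by
  have hs := summable_geometric_of_lt_one (norm_nonneg x) hx
  calc ‖∏ i ∈ Finset.range n, (1 - x ^ (k + i + 1))‖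
      ≤ ∏ i ∈ Finset.range n, Real.exp (‖x‖ ^ i) := by
        rw [norm_prod]
        refine Finset.prod_le_prod (fun _ _ => norm_nonneg _) fun i _ => ?_
        have h1 : ‖1 - x ^ (k + i + 1)‖ ≤ 1 + ‖x‖ ^ (k + i + 1) := by
          simpa using norm_sub_le (1 : ℂ) (x ^ (k + i + 1))
        have h2 : ‖x‖ ^ (k + i + 1) ≤ ‖x‖ ^ i :=
          pow_le_pow_of_le_one (norm_nonneg x) hx.le (by omega)
        linarith [Real.add_one_le_exp (‖x‖ ^ i)]
    _ = Real.exp (∑ i ∈ Finset.range n, ‖x‖ ^ i) := (Real.exp_sum _ _).symm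
    _ ≤ Real.exp (1 - ‖x‖)⁻¹ := by
        rw [← tsum_geometric_of_lt_one (norm_nonneg x) hx]
        exact Real.exp_le_exp.2 (hs.sum_le_tsum _ fun i _ => by positivity)

/-- The bound is summable in n and uniform in k, so it yields both the summability and the vanishing
remainder needed for the pentagonal number theorem. -/
theorem norm_pow_mul_prod_le {x : ℂ} (hx : ‖x‖ < 1) (k n : ℕ) :
    ‖x ^ ((k + 1) * n) * ∏ i ∈ Finset.range (n + 1), (1 - x ^ (k + i + 1))‖ ≤
      ‖x‖ ^ n * Real.exp (1 - ‖x‖)⁻¹ := by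
  rw [norm_mul, norm_pow]
  gcongr ?_ * ?_
  · exact pow_le_pow_of_le_one (norm_nonneg x) hx.le (by nlinarith)
  · exact norm_prod_range_one_sub_pow_le hx k (n + 1)

theorem summable_pentagonal {x : ℂ} (hx : ‖x‖ < 1) :
    Summable fun k : ℤ => (Int.negOnePow k : ℂ) * x ^ pentagonal k := by
  refine Summable.of_norm ?_
  refine (summable_norm_pow_of_injective hx pentagonal_injective).congr fun k => ?_
  rcases Int.even_or_odd k with h | h
  · simp [Int.negOnePow_even k h]
  · simp [Int.negOnePow_odd k h]

/-- **Euler's pentagonal number theorem** in the open unit disc. -/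
theorem hasSum_pentagonal {x : ℂ} (hx : ‖x‖ < 1) :
    HasSum (fun k : ℤ => (Int.negOnePow k : ℂ) * x ^ pentagonal k) (∏' n : ℕ, (1 - x ^ (n + 1))) := by
  have hS := (summable_pentagonal hx).hasSum
  have hN : HasSum (fun k : ℕ => (-1) ^ k * (x ^ pentagonal (-k) - x ^ pentagonal (k + 1)))
      (∑' k : ℤ, (Int.negOnePow k : ℂ) * x ^ pentagonal k) := by
    have h := hS
    -- The one-sided series pairs -k with k + 1, so the sign of the index is flipped before ℤ is
    -- folded onto ℕ.
    rw [← neg_injective.hasSum_iff (fun x hx ↦ by absurd hx; use -x; simp)] at h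
    convert h.nat_add_neg_add_one using 2 with k
    simp_rw [Function.comp_apply, neg_neg, Int.negOnePow_add]
    simp
    ring
  have hg : Summable fun n : ℕ => ‖x‖ ^ n * Real.exp (1 - ‖x‖)⁻¹ :=
    (summable_geometric_of_lt_one (norm_nonneg x) hx).mul_right _
  rw [Pentagonal.tprod_one_sub_pow, hN.tsum_eq]
  · exact hS
  · exact tendsto_pow_atTop_nhds_zero_of_norm_lt_one hx
  · exact fun k => Summable.of_norm_bounded hg fun n => norm_pow_mul_prod_le hx k n
  · exact fun k => multipliable_one_sub_pow hx (f := fun n => n + k + 1)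
      (fun a b h => by simpa using h)
  · exact hN.summable
  · refine squeeze_zero_norm (a := fun k => ‖x‖ ^ k * ∑' n, ‖x‖ ^ n * Real.exp (1 - ‖x‖)⁻¹)
      (fun k => ?_) ?_
    · rw [norm_mul, norm_mul, norm_pow, norm_neg, norm_one, one_pow, one_mul, norm_pow]
      gcongr ?_ * ?_
      · refine pow_le_pow_of_le_one (norm_nonneg x) hx.le ?_
        rw [Nat.le_div_iff_mul_le (by norm_num)]
        nlinarith
      · exact tsum_of_norm_bounded hg.hasSum fun n => norm_pow_mul_prod_le hx k n
    · simpa using (tendsto_pow_atTop_nhds_zero_of_lt_one (norm_nonneg x) hx).mul_const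
        (∑' n, ‖x‖ ^ n * Real.exp (1 - ‖x‖)⁻¹)

/-! ### Theta series of the character modulo 12 -/

/-- The quadratic character modulo `3`. -/
def chiThree (n : ℤ) : ℤ := if n % 3 = 1 then 1 else if n % 3 = 2 then -1 else 0

/-- The quadratic character modulo `4`. -/
def chiFour (n : ℤ) : ℤ := if n % 4 = 1 then 1 else if n % 4 = 3 then -1 else 0

/-- The even quadratic character modulo `12`. -/
def chiTwelve (n : ℤ) : ℤ := chiFour n * chiThree n

theorem chiTwelve_neg (n : ℤ) : chiTwelve (-n) = chiTwelve n := by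
  have h3 : chiThree (-n) = -chiThree n := by unfold chiThree; split_ifs <;> omega
  have h4 : chiFour (-n) = -chiFour n := by unfold chiFour; split_ifs <;> omega
  rw [chiTwelve, chiTwelve, h3, h4, neg_mul_neg]

theorem chiTwelve_eq_zero {n : ℤ} (h : ¬(n % 6 = 1 ∨ n % 6 = 5)) : chiTwelve n = 0 := by
  rcases (by omega : n % 2 = 0 ∨ n % 3 = 0) with h | h
  · rw [chiTwelve, chiFour, if_neg (by omega), if_neg (by omega), zero_mul]
  · rw [chiTwelve, chiThree, if_neg (by omega), if_neg (by omega), mul_zero]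

theorem chiTwelve_six_mul_sub_one (k : ℤ) : chiTwelve (6 * k - 1) = Int.negOnePow k := by
  rcases Int.even_or_odd k with h | h
  · rw [Int.negOnePow_even k h]
    obtain ⟨m, rfl⟩ := h
    have h3 : chiThree (6 * (m + m) - 1) = -1 := by unfold chiThree; split_ifs <;> omega
    have h4 : chiFour (6 * (m + m) - 1) = -1 := by unfold chiFour; split_ifs <;> omega
    simp [chiTwelve, h3, h4]
  · rw [Int.negOnePow_odd k h]
    obtain ⟨m, rfl⟩ := h
    have h3 : chiThree (6 * (2 * m + 1) - 1) = -1 := by unfold chiThree; split_ifs <;> omega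
    have h4 : chiFour (6 * (2 * m + 1) - 1) = 1 := by unfold chiFour; split_ifs <;> omega
    simp [chiTwelve, h3, h4]

theorem zpow_six_mul_sub_one_sq {z : ℂ} (k : ℤ) :
    z ^ ((6 * k - 1) ^ 2) = z * (z ^ 24) ^ pentagonal k := by
  have h : (6 * k - 1) ^ 2 = ((24 * pentagonal k + 1 : ℕ) : ℤ) := by
    have := two_mul_natCast_pentagonal k
    push_cast
    linarith
  rw [h, zpow_natCast, pow_succ, pow_mul, mul_comm]

/-- The theta series of the character modulo `12` is twice the Dedekind eta product. -/
theorem hasSum_chiTwelve {z : ℂ} (hz : ‖z‖ < 1) :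
    HasSum (fun a : ℤ => (chiTwelve a : ℂ) * z ^ (a ^ 2))
      (2 * z * ∏' n : ℕ, (1 - (z ^ 24) ^ (n + 1))) := by
  have hx : ‖z ^ 24‖ < 1 := by
    rw [norm_pow]; exact pow_lt_one₀ (norm_nonneg z) hz (by norm_num)
  set P := ∏' n : ℕ, (1 - (z ^ 24) ^ (n + 1)) with hP
  have h0 : HasSum (fun k : ℤ => (chiTwelve (6 * k - 1) : ℂ) * z ^ ((6 * k - 1) ^ 2)) (z * P) := by
    refine ((hasSum_pentagonal hx).mul_left z).congr_fun fun k => ?_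
    rw [chiTwelve_six_mul_sub_one, zpow_six_mul_sub_one_sq]
    ring
  have h1 : HasSum (fun a : ℤ => if a % 6 = 5 then (chiTwelve a : ℂ) * z ^ (a ^ 2) else 0)
      (z * P) := by
    have hi : Function.Injective fun k : ℤ => 6 * k - 1 := fun a b h => by
      simp only at h; omega
    rw [← hi.hasSum_iff]
    · refine h0.congr_fun fun k => ?_
      simp only [Function.comp_apply]
      rw [if_pos (by omega)]
    · intro a ha
      refine if_neg fun h => ha ⟨(a + 1) / 6, ?_⟩
      simp only; omega
  have h2 : HasSum (fun a : ℤ => if a % 6 = 1 then (chiTwelve a : ℂ) * z ^ (a ^ 2) else 0)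
      (z * P) := by
    -- The class 1 mod 6 is the negative of the class 5, and the terms are even in a.
    rw [← (Equiv.neg ℤ).hasSum_iff]
    refine h1.congr_fun fun a => ?_
    simp only [Function.comp_apply, Equiv.neg_apply, chiTwelve_neg, neg_sq]
    exact if_congr (by omega) rfl rfl
  have h := h1.add h2
  rw [show 2 * z * P = z * P + z * P by ring]
  refine h.congr_fun fun a => ?_
  by_cases h5 : a % 6 = 5
  · simp [h5]
  by_cases h6 : a % 6 = 1
  · simp [h6]
  · simp [h5, h6, chiTwelve_eq_zero (n := a) (by tauto)]

/-! ### Binary theta series of a² + 7b² -/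

theorem norm_pow_lt_one {z : ℂ} (hz : ‖z‖ < 1) {n : ℕ} (hn : n ≠ 0) : ‖z ^ n‖ < 1 := by
  rw [norm_pow]; exact pow_lt_one₀ (norm_nonneg z) hz hn

/-- The general term of the binary theta series of the form `a ^ 2 + 7 * b ^ 2`. -/
noncomputable def thetaTerm (z : ℂ) (p : ℤ × ℤ) : ℂ :=
  (chiTwelve p.1 * chiTwelve p.2 : ℂ) * z ^ (p.1 ^ 2 + 7 * p.2 ^ 2)

theorem thetaTerm_eq_zero (z : ℂ) {p : ℤ × ℤ} (h : p.1 % 2 = 0 ∨ p.2 % 2 = 0) :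
    thetaTerm z p = 0 := by
  rcases h with h | h
  · simp [thetaTerm, chiTwelve_eq_zero (n := p.1) (by omega)]
  · simp [thetaTerm, chiTwelve_eq_zero (n := p.2) (by omega)]

theorem hasSum_thetaTerm {z : ℂ} (hz0 : z ≠ 0) (hz : ‖z‖ < 1) :
    HasSum (thetaTerm z) (4 * z ^ 8 * ((∏' n : ℕ, (1 - (z ^ 24) ^ (n + 1))) *
      ∏' n : ℕ, (1 - ((z ^ 24) ^ 7) ^ (n + 1)))) := by
  have h1 := hasSum_chiTwelve hz
  have h2 := hasSum_chiTwelve (norm_pow_lt_one hz (n := 7) (by norm_num))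
  have hs := summable_mul_of_summable_norm h1.summable.norm h2.summable.norm
  have h := h1.mul h2 hs
  have e : (z ^ 7) ^ 24 = (z ^ 24) ^ 7 := by ring
  rw [e] at h
  rw [show ∀ u v : ℂ, 4 * z ^ 8 * (u * v) = 2 * z * u * (2 * z ^ 7 * v) from fun u v => by ring]
  refine h.congr_fun fun p => ?_
  have e' : (z ^ 7) ^ (p.2 ^ 2) = z ^ (7 * p.2 ^ 2) := by
    rw [zpow_mul]; norm_cast
  rw [thetaTerm.eq_1, zpow_add₀ hz0, e']
  ring

/-- The terms with `8 ∣ a - 3 * b` make up one half of those with `16 ∣ a ^ 2 + 7 * b ^ 2`. -/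
theorem thetaTerm_split (z : ℂ) (p : ℤ × ℤ) :
    (if 16 ∣ p.1 ^ 2 + 7 * p.2 ^ 2 then thetaTerm z p else 0) =
      (if 8 ∣ p.1 - 3 * p.2 then thetaTerm z p else 0) +
        if 8 ∣ p.1 + 3 * p.2 then thetaTerm z p else 0 := by
  by_cases h0 : p.1 % 2 = 0 ∨ p.2 % 2 = 0
  · simp [thetaTerm_eq_zero z h0]
  obtain ⟨a, b⟩ := p
  simp only at h0 ⊢
  obtain ⟨m, rfl⟩ : ∃ m, a = 2 * m + 1 := ⟨a / 2, by omega⟩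
  obtain ⟨n, rfl⟩ : ∃ n, b = 2 * n + 1 := ⟨b / 2, by omega⟩
  have hnot : ¬((8 : ℤ) ∣ 2 * m + 1 - 3 * (2 * n + 1) ∧ (8 : ℤ) ∣ 2 * m + 1 + 3 * (2 * n + 1)) := by
    omega
  have hiff : (16 : ℤ) ∣ (2 * m + 1) ^ 2 + 7 * (2 * n + 1) ^ 2 ↔
      (8 : ℤ) ∣ 2 * m + 1 - 3 * (2 * n + 1) ∨ (8 : ℤ) ∣ 2 * m + 1 + 3 * (2 * n + 1) := by
    -- The square of an odd integer mod 16 depends only on that integer mod 8, so m and n matter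
    -- only mod 4.
    obtain ⟨u, r, hr, rfl⟩ : ∃ u r, (r = 0 ∨ r = 1 ∨ r = 2 ∨ r = 3) ∧ m = 4 * u + r :=
      ⟨m / 4, m % 4, by omega, by omega⟩
    obtain ⟨v, s, hs, rfl⟩ : ∃ v s, (s = 0 ∨ s = 1 ∨ s = 2 ∨ s = 3) ∧ n = 4 * v + s :=
      ⟨n / 4, n % 4, by omega, by omega⟩
    rcases hr with rfl | rfl | rfl | rfl <;> rcases hs with rfl | rfl | rfl | rfl <;>
      ring_nf <;> omega
  by_cases hA : (8 : ℤ) ∣ 2 * m + 1 - 3 * (2 * n + 1)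
  · have hB : ¬(8 : ℤ) ∣ 2 * m + 1 + 3 * (2 * n + 1) := fun hB => hnot ⟨hA, hB⟩
    rw [if_pos (hiff.2 (Or.inl hA)), if_pos hA, if_neg hB, add_zero]
  · by_cases hB : (8 : ℤ) ∣ 2 * m + 1 + 3 * (2 * n + 1)
    · rw [if_pos (hiff.2 (Or.inr hB)), if_neg hA, if_pos hB, zero_add]
    · rw [if_neg (fun h => (hiff.1 h).elim hA hB), if_neg hA, if_neg hB, add_zero]

theorem thetaTerm_neg_snd (z : ℂ) (a b : ℤ) : thetaTerm z (a, -b) = thetaTerm z (a, b) := by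
  simp [thetaTerm, chiTwelve_neg]

theorem summable_thetaTerm_ite {z : ℂ} (hz0 : z ≠ 0) (hz : ‖z‖ < 1) (P : ℤ × ℤ → Prop)
    [DecidablePred P] : Summable fun p => if P p then thetaTerm z p else 0 := by
  refine ((hasSum_thetaTerm hz0 hz).summable.indicator {p | P p}).congr fun p => ?_
  simp [Set.indicator_apply]

theorem tsum_thetaTerm_sixteen {z : ℂ} (hz0 : z ≠ 0) (hz : ‖z‖ < 1) :
    ∑' p : ℤ × ℤ, (if 16 ∣ p.1 ^ 2 + 7 * p.2 ^ 2 then thetaTerm z p else 0) =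
      2 * ∑' p : ℤ × ℤ, if 8 ∣ p.1 - 3 * p.2 then thetaTerm z p else 0 := by
  simp_rw [thetaTerm_split]
  rw [(summable_thetaTerm_ite hz0 hz _).tsum_add (summable_thetaTerm_ite hz0 hz _), two_mul]
  congr 1
  rw [← ((Equiv.refl ℤ).prodCongr (Equiv.neg ℤ)).tsum_eq]
  refine tsum_congr fun ⟨a, b⟩ => ?_
  simp [thetaTerm_neg_snd, sub_eq_add_neg]

/-- For odd a and b exactly one of a - b, a + b is divisible by 4, and b ↦ -b exchanges the two
cases. -/
theorem tsum_thetaTerm_four {z : ℂ} (hz0 : z ≠ 0) (hz : ‖z‖ < 1) :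
    ∑' p : ℤ × ℤ, thetaTerm z p =
      2 * ∑' p : ℤ × ℤ, if 4 ∣ p.1 - p.2 then thetaTerm z p else 0 := by
  have hsplit (p : ℤ × ℤ) : thetaTerm z p = (if 4 ∣ p.1 - p.2 then thetaTerm z p else 0) +
      if 4 ∣ p.1 + p.2 then thetaTerm z p else 0 := by
    by_cases h0 : p.1 % 2 = 0 ∨ p.2 % 2 = 0
    · simp [thetaTerm_eq_zero z h0]
    by_cases h : 4 ∣ p.1 - p.2
    · rw [if_pos h, if_neg (by omega), add_zero]
    · rw [if_neg h, if_pos (by omega), zero_add]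
  rw [tsum_congr hsplit, (summable_thetaTerm_ite hz0 hz _).tsum_add
    (summable_thetaTerm_ite hz0 hz _), two_mul]
  congr 1
  rw [← ((Equiv.refl ℤ).prodCongr (Equiv.neg ℤ)).tsum_eq]
  refine tsum_congr fun ⟨a, b⟩ => ?_
  simp [thetaTerm_neg_snd, sub_eq_add_neg]

/-! ### The form b² + 3bd + 4d² of discriminant -7 -/

/-- The general term of the theta series in the coordinates `a = 3 * b + 8 * d`. -/
noncomputable def reducedTerm (z : ℂ) (p : ℤ × ℤ) : ℂ :=
  (chiThree p.1 * chiThree p.2 : ℂ) * z ^ (16 * (p.1 ^ 2 + 3 * p.1 * p.2 + 4 * p.2 ^ 2))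

theorem thetaTerm_three_mul_add (z : ℂ) (b d : ℤ) :
    thetaTerm z (3 * b + 8 * d, b) = if b % 2 = 1 then reducedTerm z (b, d) else 0 := by
  by_cases hb : b % 2 = 1
  · have h : chiTwelve (3 * b + 8 * d) * chiTwelve b = chiThree b * chiThree d := by
      have h3 : chiThree (3 * b + 8 * d) = -chiThree d := by unfold chiThree; split_ifs <;> omega
      have h4 : chiFour (3 * b + 8 * d) = -chiFour b := by unfold chiFour; split_ifs <;> omega
      have h5 : chiFour b * chiFour b = 1 := by unfold chiFour; split_ifs <;> first | rfl | omega
      rw [chiTwelve, chiTwelve, h3, h4]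
      linear_combination chiThree b * chiThree d * h5
    rw [if_pos hb, thetaTerm, reducedTerm, ← Int.cast_mul, ← Int.cast_mul, h]
    congr 2
    ring
  · rw [if_neg hb, thetaTerm_eq_zero z (Or.inr (by simp only; omega))]

theorem reducedTerm_eq (z : ℂ) {b d : ℤ} (hb : b % 2 = 1) (hd : d % 2 = 1) :
    reducedTerm z (b, d) = -thetaTerm (z ^ 4) (3 * d + 2 * b, d) := by
  have h : chiTwelve (3 * d + 2 * b) * chiTwelve d = -(chiThree b * chiThree d) := by
    have h3 : chiThree (3 * d + 2 * b) = -chiThree b := by unfold chiThree; split_ifs <;> omega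
    have h4 : chiFour (3 * d + 2 * b) = chiFour d := by unfold chiFour; split_ifs <;> omega
    have h5 : chiFour d * chiFour d = 1 := by unfold chiFour; split_ifs <;> first | rfl | omega
    rw [chiTwelve, chiTwelve, h3, h4]
    linear_combination -(chiThree b * chiThree d) * h5
  rw [thetaTerm, reducedTerm, ← Int.cast_mul, ← Int.cast_mul, h, ← zpow_natCast, ← zpow_mul]
  push_cast
  rw [neg_mul, neg_neg]
  congr 2
  ring

/-- The map b ↦ -b - 3d preserves the form, while the odd character mod 3 changes sign. -/
theorem reducedTerm_neg_sub (z : ℂ) (b d : ℤ) :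
    reducedTerm z (-b - 3 * d, d) = -reducedTerm z (b, d) := by
  have h3 : chiThree (-b - 3 * d) = -chiThree b := by unfold chiThree; split_ifs <;> omega
  rw [reducedTerm, reducedTerm]
  simp only [h3]
  rw [show 16 * ((-b - 3 * d) ^ 2 + 3 * (-b - 3 * d) * d + 4 * d ^ 2) =
    16 * (b ^ 2 + 3 * b * d + 4 * d ^ 2) by ring]
  push_cast
  ring

theorem tsum_thetaTerm_eight {z : ℂ} (hz0 : z ≠ 0) (hz : ‖z‖ < 1) :
    ∑' p : ℤ × ℤ, (if 8 ∣ p.1 - 3 * p.2 then thetaTerm z p else 0) =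
      -∑' p : ℤ × ℤ, if 4 ∣ p.1 - p.2 then thetaTerm (z ^ 4) p else 0 := by
  have hi : Function.Injective fun p : ℤ × ℤ => (3 * p.1 + 8 * p.2, p.1) := by
    rintro ⟨a, b⟩ ⟨c, d⟩ h
    simp only [Prod.mk.injEq] at h ⊢
    omega
  have hj : Function.Injective fun p : ℤ × ℤ => (3 * p.2 + 2 * p.1, p.2) := by
    rintro ⟨a, b⟩ ⟨c, d⟩ h
    simp only [Prod.mk.injEq] at h ⊢
    omega
  have hA := (summable_thetaTerm_ite hz0 hz fun p => 8 ∣ p.1 - 3 * p.2).hasSum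
  rw [← hi.hasSum_iff] at hA
  swap
  · rintro ⟨a, b⟩ h
    refine if_neg fun h' => h ⟨(b, (a - 3 * b) / 8), ?_⟩
    have h8 : 3 * b + 8 * ((a - 3 * b) / 8) = a := by
      simp only at h'; omega
    simp [h8]
  have hB := (summable_thetaTerm_ite (pow_ne_zero 4 hz0) (norm_pow_lt_one hz (n := 4) (by norm_num))
    fun p => 4 ∣ p.1 - p.2).hasSum
  rw [← hj.hasSum_iff] at hB
  swap
  · rintro ⟨c, d⟩ h
    by_cases h0 : c % 2 = 0 ∨ d % 2 = 0
    · simp [thetaTerm_eq_zero (z ^ 4) (p := (c, d)) h0]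
    refine if_neg fun h' => h ⟨((c - 3 * d) / 2, d), ?_⟩
    have h2 : 3 * d + 2 * ((c - 3 * d) / 2) = c := by omega
    simp [h2]
  have hE := hA.add hB
  let σ : ℤ × ℤ ≃ ℤ × ℤ :=
    { toFun := fun p => (-p.1 - 3 * p.2, p.2)
      invFun := fun p => (-p.1 - 3 * p.2, p.2)
      left_inv := fun p => by ext <;> simp
      right_inv := fun p => by ext <;> simp }
  -- What remains after adding the two sums: for b, d both odd, `reducedTerm_eq` makes their terms
  -- cancel. The involution σ preserves these parities and negates the rest.
  set f : ℤ × ℤ → ℂ := fun p => if p.1 % 2 = 1 ∧ p.2 % 2 = 0 then reducedTerm z p else 0 with hf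
  have hfE : HasSum f _ := hE.congr_fun (g := f) fun p => by
    obtain ⟨b, d⟩ := p
    simp only [Function.comp_apply, hf]
    rw [if_pos (by omega : 8 ∣ 3 * b + 8 * d - 3 * b), thetaTerm_three_mul_add]
    rcases Int.emod_two_eq_zero_or_one b with hb | hb <;>
      rcases Int.emod_two_eq_zero_or_one d with hd | hd
    · rw [thetaTerm_eq_zero (z ^ 4) (Or.inr hd)]
      simp [hb]
    · rw [if_neg (by omega), if_neg (by omega), if_neg (by omega), add_zero]
    · rw [thetaTerm_eq_zero (z ^ 4) (Or.inr hd)]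
      simp [hb, hd]
    · rw [if_neg (by omega : ¬(b % 2 = 1 ∧ d % 2 = 0)), if_pos hb,
        if_pos (by omega : 4 ∣ 3 * d + 2 * b - d), reducedTerm_eq z hb hd, neg_add_cancel]
  have hσ : ∑' p, f p = -∑' p, f p := by
    conv_lhs => rw [← σ.tsum_eq]
    rw [← tsum_neg]
    refine tsum_congr fun p => ?_
    obtain ⟨b, d⟩ := p
    simp only [hf, σ, Equiv.coe_fn_mk, reducedTerm_neg_sub]
    by_cases h : b % 2 = 1 ∧ d % 2 = 0
    · rw [if_pos h, if_pos (by omega)]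
    · rw [if_neg h, if_neg (by omega), neg_zero]
  have h0 : ∑' p, f p = 0 := self_eq_neg.1 hσ
  rw [hfE.tsum_eq] at h0
  exact eq_neg_of_add_eq_zero_left h0

/-! ### Extracting the odd part with a root of unity -/

theorem sq_add_seven_mul_sq_emod {a b : ℤ} (ha : a % 6 = 1 ∨ a % 6 = 5)
    (hb : b % 6 = 1 ∨ b % 6 = 5) : ∃ k, a ^ 2 + 7 * b ^ 2 = 8 + 24 * k := by
  have h {c : ℤ} (hc : c % 6 = 1 ∨ c % 6 = 5) : ∃ k, c ^ 2 = 1 + 24 * k := by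
    obtain ⟨m, hm⟩ : ∃ m, m = c / 6 := ⟨_, rfl⟩
    obtain ⟨k, hk⟩ := Int.even_mul_succ_self m
    rcases hc with hc | hc
    · have : c = 6 * m + 1 := by omega
      exact ⟨k + m ^ 2, by rw [this]; linear_combination 12 * hk⟩
    · have : c = 6 * m + 5 := by omega
      exact ⟨3 * k + m + 1, by rw [this]; linear_combination 36 * hk⟩
  obtain ⟨k, hk⟩ := h ha
  obtain ⟨l, hl⟩ := h hb
  exact ⟨k + 7 * l, by linear_combination hk + 7 * hl⟩

/-- On nonzero terms the exponent is 8 + 24k, so the twist contributes ζ^8 (-1)^k; and 16 divides 8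
+ 24k exactly when k is odd. -/
theorem thetaTerm_twist {ζ : ℂ} (hζ : ζ ^ 24 = -1) (z : ℂ) (p : ℤ × ℤ) :
    ζ ^ 8 * thetaTerm z p - thetaTerm (ζ * z) p =
      2 * ζ ^ 8 * if 16 ∣ p.1 ^ 2 + 7 * p.2 ^ 2 then thetaTerm z p else 0 := by
  have hζ0 : ζ ≠ 0 := by rintro rfl; norm_num at hζ
  by_cases ha : p.1 % 6 = 1 ∨ p.1 % 6 = 5
  swap
  · simp [thetaTerm, chiTwelve_eq_zero ha]
  by_cases hb : p.2 % 6 = 1 ∨ p.2 % 6 = 5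
  swap
  · simp [thetaTerm, chiTwelve_eq_zero hb]
  obtain ⟨k, hk⟩ := sq_add_seven_mul_sq_emod ha hb
  have hpow : ζ ^ (8 + 24 * k) = ζ ^ 8 * (-1) ^ k := by
    rw [zpow_add₀ hζ0, zpow_mul, ← hζ]
    norm_cast
  rw [thetaTerm, thetaTerm, mul_zpow, hk, hpow]
  rcases Int.even_or_odd k with h | h
  · rw [h.neg_one_zpow, if_neg (by obtain ⟨m, rfl⟩ := h; omega)]
    ring
  · rw [h.neg_one_zpow, if_pos (by obtain ⟨m, rfl⟩ := h; omega)]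
    ring

/-- The odd part of `E(x) * E(x ^ 7)` is `-x * E(x ^ 4) * E(x ^ 28)`, where `E` is the Euler
product. -/
theorem tprod_one_sub_pow_mul_seven_sub {x : ℂ} (hx0 : x ≠ 0) (hx : ‖x‖ < 1) :
    (∏' n : ℕ, (1 - x ^ (n + 1))) * (∏' n : ℕ, (1 - (x ^ 7) ^ (n + 1))) -
      (∏' n : ℕ, (1 - (-x) ^ (n + 1))) * (∏' n : ℕ, (1 - ((-x) ^ 7) ^ (n + 1))) =
    -2 * x * ((∏' n : ℕ, (1 - (x ^ 4) ^ (n + 1))) * ∏' n : ℕ, (1 - ((x ^ 4) ^ 7) ^ (n + 1))) := by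
  obtain ⟨z, rfl⟩ := IsAlgClosed.exists_pow_nat_eq x (n := 24) (by norm_num)
  obtain ⟨ζ, hζ⟩ := IsAlgClosed.exists_pow_nat_eq (-1 : ℂ) (n := 24) (by norm_num)
  have hζ0 : ζ ≠ 0 := by rintro rfl; norm_num at hζ
  have hz0 : z ≠ 0 := by rintro rfl; norm_num at hx0
  have hz : ‖z‖ < 1 := by
    rwa [norm_pow, pow_lt_one_iff_of_nonneg (norm_nonneg z) (by norm_num)] at hx
  have hnζ : ‖ζ‖ = 1 := by
    have : ‖ζ‖ ^ 24 = 1 := by rw [← norm_pow, hζ, norm_neg, norm_one]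
    exact (pow_eq_one_iff_of_nonneg (norm_nonneg ζ) (by norm_num)).1 this
  have h1 := hasSum_thetaTerm hz0 hz
  have h2 := hasSum_thetaTerm (mul_ne_zero hζ0 hz0) (by rw [norm_mul, hnζ, one_mul]; exact hz)
  have h3 := (hasSum_thetaTerm (pow_ne_zero 4 hz0)
    (norm_pow_lt_one hz (n := 4) (by norm_num))).tsum_eq
  have e2 : (ζ * z) ^ 24 = -z ^ 24 := by rw [mul_pow, hζ, neg_one_mul]
  have e3 : (z ^ 4) ^ 24 = (z ^ 24) ^ 4 := by ring
  rw [e2] at h2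
  rw [e3, tsum_thetaTerm_four (pow_ne_zero 4 hz0) (norm_pow_lt_one hz (n := 4) (by norm_num))] at h3
  have h4 := ((h1.mul_left (ζ ^ 8)).sub h2).tsum_eq
  simp_rw [thetaTerm_twist hζ] at h4
  rw [tsum_mul_left, tsum_thetaTerm_sixteen hz0 hz, tsum_thetaTerm_eight hz0 hz] at h4
  have hne : 4 * ζ ^ 8 * z ^ 8 ≠ 0 :=
    mul_ne_zero (mul_ne_zero (by norm_num) (pow_ne_zero 8 hζ0)) (pow_ne_zero 8 hz0)
  refine mul_left_cancel₀ hne ?_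
  linear_combination -h4 - 2 * ζ ^ 8 * h3

/-! ### Euler product manipulations and the conclusion -/

theorem tprod_one_sub_pow_eq_odd_mul {x : ℂ} (hx : ‖x‖ < 1) :
    ∏' n : ℕ, (1 - x ^ (n + 1)) =
      (∏' n : ℕ, (1 - x ^ (2 * n + 1))) * ∏' n : ℕ, (1 - (x ^ 2) ^ (n + 1)) := by
  rw [← tprod_even_mul_odd (f := fun n => 1 - x ^ (n + 1))
    (multipliable_one_sub_pow hx fun a b h => by omega)
    (multipliable_one_sub_pow hx fun a b h => by omega)]
  congr 2
  ext n
  rw [← pow_mul]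
  ring

theorem tprod_one_sub_sq_pow {x : ℂ} (hx : ‖x‖ < 1) :
    ∏' n : ℕ, (1 - (x ^ 2) ^ (n + 1)) =
      (∏' n : ℕ, (1 - x ^ (n + 1))) * ∏' n : ℕ, (1 + x ^ (n + 1)) := by
  rw [← (multipliable_one_sub_pow hx (add_left_injective 1)).tprod_mul
    (multipliable_one_add_pow hx (add_left_injective 1))]
  exact tprod_congr fun n => by ring

theorem tprod_one_sub_pow_ne_zero {x : ℂ} (hx : ‖x‖ < 1) : ∏' n : ℕ, (1 - x ^ (n + 1)) ≠ 0 := by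
  simp_rw [sub_eq_add_neg]
  refine tprod_one_add_ne_zero_of_summable (fun n h => ?_)
    (by simpa using summable_norm_pow_of_injective hx (add_left_injective 1))
  have := norm_pow_lt_one hx n.succ_ne_zero
  rw [← sub_eq_add_neg, sub_eq_zero] at h
  rw [Nat.succ_eq_add_one, ← h, norm_one] at this
  exact lt_irrefl _ this

/-- For every complex `q` with `0 < |q| < 1` and every square root `s` of `q`. The products over
`n ≥ 1` are indexed by `n : ℕ` through `n ↦ n + 1`; half-integral powers of `q` are powers of `s`:
`q ^ (7 * (n + 1) - 7 / 2) = s ^ (14 * n + 7)` and `q ^ ((n + 1) - 1 / 2) = s ^ (2 * n + 1)`.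
Convergence of the three infinite products is part of the claim. -/
theorem mainTheorem9 (q s : ℂ) (hq0 : q ≠ 0) (hq : ‖q‖ < 1) (hs : s ^ 2 = q) :
    Multipliable (fun n : ℕ => (1 + s ^ (14 * n + 7)) * (1 + s ^ (2 * n + 1))) ∧
    Multipliable (fun n : ℕ => (1 - s ^ (14 * n + 7)) * (1 - s ^ (2 * n + 1))) ∧
    Multipliable (fun n : ℕ => (1 + q ^ (7 * (n + 1))) * (1 + q ^ (n + 1))) ∧
    1 / (2 * s) *
        ((∏' n : ℕ, (1 + s ^ (14 * n + 7)) * (1 + s ^ (2 * n + 1))) -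
          ∏' n : ℕ, (1 - s ^ (14 * n + 7)) * (1 - s ^ (2 * n + 1))) =
      ∏' n : ℕ, (1 + q ^ (7 * (n + 1))) * (1 + q ^ (n + 1)) := by
  have hs0 : s ≠ 0 := by rintro rfl; exact hq0 (by rw [← hs]; norm_num)
  have hs1 : ‖s‖ < 1 := by
    rwa [← hs, norm_pow, pow_lt_one_iff_of_nonneg (norm_nonneg s) (by norm_num)] at hq
  have h7 : Function.Injective fun n : ℕ => 14 * n + 7 := fun a b h => by simp only at h; omega
  have h1 : Function.Injective fun n : ℕ => 2 * n + 1 := fun a b h => by simp only at h; omega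
  have h7' : Function.Injective fun n : ℕ => 7 * (n + 1) := fun a b h => by simp only at h; omega
  have hA7 := multipliable_one_add_pow hs1 h7
  have hA1 := multipliable_one_add_pow hs1 h1
  have hS7 := multipliable_one_sub_pow hs1 h7
  have hS1 := multipliable_one_sub_pow hs1 h1
  have hQ7 := multipliable_one_add_pow hq h7'
  have hQ1 := multipliable_one_add_pow hq (add_left_injective 1)
  refine ⟨hA7.mul hA1, hS7.mul hS1, hQ7.mul hQ1, ?_⟩
  rw [hA7.tprod_mul hA1, hS7.tprod_mul hS1, hQ7.tprod_mul hQ1]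
  have hs7 : ‖s ^ 7‖ < 1 := norm_pow_lt_one hs1 (by norm_num)
  have hq7 : ‖q ^ 7‖ < 1 := norm_pow_lt_one hq (by norm_num)
  have key := tprod_one_sub_pow_mul_seven_sub hs0 hs1
  -- Both products on the left acquire the factor E(q)E(q^7); on the right E(q²)E(q^14) contains it
  -- as well, leaving ∏(1 + q^n)(1 + q^(7n)).
  rw [tprod_one_sub_pow_eq_odd_mul hs1, tprod_one_sub_pow_eq_odd_mul hs7,
    tprod_one_sub_pow_eq_odd_mul (x := -s) (by rwa [norm_neg]),
    tprod_one_sub_pow_eq_odd_mul (x := (-s) ^ 7) (by rwa [norm_pow, norm_neg, ← norm_pow]),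
    show s ^ 4 = q ^ 2 by rw [← hs]; ring, show (q ^ 2) ^ 7 = (q ^ 7) ^ 2 by ring,
    show ((-s) ^ 7) ^ 2 = q ^ 7 by rw [← hs]; ring, show (s ^ 7) ^ 2 = q ^ 7 by rw [← hs]; ring,
    neg_sq, hs, tprod_one_sub_sq_pow hq, tprod_one_sub_sq_pow hq7] at key
  have e1 (n : ℕ) : 1 - (-s) ^ (2 * n + 1) = 1 + s ^ (2 * n + 1) := by
    rw [Odd.neg_pow ⟨n, rfl⟩, sub_neg_eq_add]
  have e2 (n : ℕ) : 1 - ((-s) ^ 7) ^ (2 * n + 1) = 1 + s ^ (14 * n + 7) := by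
    rw [← pow_mul, Odd.neg_pow ⟨7 * n + 3, by ring⟩, sub_neg_eq_add]
    ring
  have e3 (n : ℕ) : (s ^ 7) ^ (2 * n + 1) = s ^ (14 * n + 7) := by ring
  have e4 (n : ℕ) : (q ^ 7) ^ (n + 1) = q ^ (7 * (n + 1)) := (pow_mul q 7 (n + 1)).symm
  have n1 := tprod_one_sub_pow_ne_zero hq
  have n7 := tprod_one_sub_pow_ne_zero hq7
  simp_rw [e4] at n7
  simp_rw [e1, e2, e3, e4] at key
  rw [one_div, inv_mul_eq_iff_eq_mul₀ (mul_ne_zero two_ne_zero hs0)]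
  refine mul_left_cancel₀ (mul_ne_zero n1 n7) ?_
  linear_combination -key
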